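/- Notation. For $n\ge 3$ let $Q_{2^n}=\langle x,y\mid x^{2^{n-1}}=y^4=1,\ yxy^{-1}=x^{-1},\ x^{2^{n-2}}=y^2\rangle$ be the generalized quaternion group of order $2^n$; a *quaternion group* is a group isomorphic to some $Q_{2^n}$ with $n\ge 3$. For $m\ge 0$ let $\mathcal G_m$ be the space of marked groups $(G,S)$, where $S$ is an $m$-tuple generating $G$, up to isomorphisms respecting the tuples; it is identified with the set of normal subgroups of the free group $\mathbb F_m$ by $(G,S)\mapsto\{w\in\mathbb F_m : w(S)=1\}$, with the topology induced by the product topology of $2^{\mathbb F_m}$. $\mathrm{Th}_\forall(H)$ is the set of universal first-order sentences (in the language $(1,{}^{-1},\cdot)$ of groups) that are true in the group $H$. Theorem. Let $G$ be a non-abelian finitely generated group. The following five conditions are equivalent: (1) $G$ is a limit of quaternion groups: for some $m$ there are a generating $m$-tuple $S$ of $G$ and a sequence $(H_i,T_i)$ in $\mathcal G_m$, each $H_i$ a quaternion group, that converges to $(G,S)$ in $\mathcal G_m$. (2) $G$ is fully residually quaternion: for every finite subset $E\subseteq G$ there are a quaternion group $H$ and a homomorphism $\alpha:G\to H$ whose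 restriction to $E$ is injective. (3) There are integers $l\ge 0$ and $k\ge 1$ such that $$G\cong\frac{\mathbb Z_4\ltimes(\mathbb Z^l\oplus\mathbb Z_{2^k})}{\langle(2,2^{k-1})\rangle},$$ where $\mathbb Z_4$ acts on $\mathbb Z^l\oplus\mathbb Z_{2^k}$ by $x\cdot a=(-1)^x a$, and $(2,2^{k-1})$ is the element with $\mathbb Z_4$-component $2$, $\mathbb Z^l$-component $0$ and $\mathbb Z_{2^k}$-component $2^{k-1}$. (4) $\bigcap_{n\ge 3}\mathrm{Th}_\forall(Q_{2^n})\subseteq \mathrm{Th}_\forall(G)$. (5) $G$ embeds in an ultraproduct $\prod_i H_i/\mathcal U$ for some sequence $(H_i)_{i\in\mathbb N}$ of quaternion groups and some ultrafilter $\mathcal U$ on $\mathbb N$. -/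

import Mathlib

open FirstOrder Filter Topology

namespace QuaternionLimits

/-! ### Generalized quaternion groups -/

/-- The generalized quaternion group `Q_{2^n}` of order `2^n`, meaningful for `n ≥ 3`.
Mathlib's `QuaternionGroup m` is `⟨a, x | a^(2m) = 1, x² = a^m, x⁻¹ a x = a⁻¹⟩`, of order `4m`. -/
abbrev Q (n : ℕ) : Type := QuaternionGroup (2 ^ (n - 2))

/-- The class of (generalized) quaternion groups: the groups isomorphic to `Q_{2^n}`, `n ≥ 3`. -/
def IsQuaternion (H : Type) [Group H] : Prop :=
  ∃ n : ℕ, 3 ≤ n ∧ Nonempty (H ≃* Q n)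

/-! ### The space of marked groups -/

/-- The space `𝒢_m` of groups marked by `m` generators, up to marked isomorphism, identified with
the set of normal subgroups of the free group of rank `m`. -/
structure MarkedGroupSpace (m : ℕ) where
  /-- the subgroup of the words in the marking that are trivial in the marked group -/
  relations : Subgroup (FreeGroup (Fin m))
  normal : relations.Normal

open Classical in
/-- The topology of `𝒢_m` as a subspace of `2^{𝔽_m}` with the product topology. -/
noncomputable instance (m : ℕ) : TopologicalSpace (MarkedGroupSpace m) :=
  TopologicalSpace.induced
    (fun N (w : FreeGroup (Fin m)) => (decide (w ∈ N.relations) : Bool)) inferInstance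

/-- `S` is a marking of `G`: an `m`-tuple of elements that generates `G`. -/
def IsMarking {G : Type*} [Group G] {m : ℕ} (S : Fin m → G) : Prop :=
  Subgroup.closure (Set.range S) = ⊤

/-- The point of `𝒢_m` given by the marked group `(G, S)`: all words `w` with `w(S) = 1`. -/
def markedPoint {G : Type*} [Group G] {m : ℕ} (S : Fin m → G) : MarkedGroupSpace m where
  relations := (FreeGroup.lift S).ker
  normal := inferInstance

/-- `G` is a limit of groups in the class `X`: for some `m`, some marking `S` of `G` by `m` elements
and some sequence of marked groups `(H i, T i)` with `H i` in `X`, `(H i, T i)` converges to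
`(G, S)` in `𝒢_m`. -/
def IsLimitOf (X : (H : Type) → [Group H] → Prop) (G : Type*) [Group G] : Prop :=
  ∃ (m : ℕ) (S : Fin m → G) (H : ℕ → Type) (_ : ∀ i, Group (H i)) (T : ∀ i, Fin m → H i),
    IsMarking S ∧ (∀ i, X (H i)) ∧ (∀ i, IsMarking (T i)) ∧
      Tendsto (fun i => markedPoint (T i)) atTop (𝓝 (markedPoint S))

/-! ### Fully residual properties -/

/-- `G` is fully residually `X`: every finite subset of `G` is mapped injectively by some
homomorphism from `G` to a group in `X`. -/
def FullyResidually (X : (H : Type) → [Group H] → Prop) (G : Type*) [Group G] : Prop :=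
  ∀ E : Finset G, ∃ (H : Type) (_ : Group H), X H ∧ ∃ α : G →* H, Set.InjOn α (E : Set G)

/-! ### The groups `(ℤ₄ ⋉ (ℤ^l ⊕ ℤ_{2^k})) / ⟨(2, 2^{k-1})⟩` -/

theorem neg_one_pow_val_add (x y : ZMod 4) :
    (-1 : ℤ) ^ (x + y).val = (-1) ^ x.val * (-1) ^ y.val := by
  revert x y; decide

/-- The action of `ℤ₄` on an abelian group `A` (written additively) by `x · a = (-1)^x a`. -/
def signAction (A : Type*) [AddCommGroup A] :
    Multiplicative (ZMod 4) →* MulAut (Multiplicative A) where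
  toFun x :=
    { toFun := fun a => .ofAdd ((-1 : ℤ) ^ (x.toAdd).val • a.toAdd)
      invFun := fun a => .ofAdd ((-1 : ℤ) ^ (x.toAdd).val • a.toAdd)
      left_inv := fun a => by simp [smul_smul, ← mul_pow]
      right_inv := fun a => by simp [smul_smul, ← mul_pow]
      map_mul' := fun a b => by simp [smul_add] }
  map_one' := by
    ext a
    simp
  map_mul' x y := by
    ext a
    change Multiplicative.ofAdd ((-1 : ℤ) ^ (x.toAdd + y.toAdd).val • a.toAdd) =
      .ofAdd ((-1 : ℤ) ^ (x.toAdd).val • ((-1 : ℤ) ^ (y.toAdd).val • a.toAdd))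
    rw [neg_one_pow_val_add, smul_smul]

/-- The semidirect product `ℤ₄ ⋉ (ℤ^l ⊕ ℤ_{2^k})`. In Mathlib's order of the components, the pair
with `ℤ₄`-part `x` and abelian part `a` is written `⟨a, x⟩`. -/
abbrev SemiProd (l k : ℕ) : Type :=
  Multiplicative ((Fin l → ℤ) × ZMod (2 ^ k)) ⋊[signAction ((Fin l → ℤ) × ZMod (2 ^ k))]
    Multiplicative (ZMod 4)

/-- The element `(2, 2^{k-1})` of `ℤ₄ ⋉ (ℤ^l ⊕ ℤ_{2^k})` (used for `k ≥ 1`). -/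
def centralElt (l k : ℕ) : SemiProd l k :=
  ⟨.ofAdd (0, 2 ^ (k - 1)), .ofAdd 2⟩

theorem neg_two_pow_pred (k : ℕ) : -(2 ^ (k - 1) : ZMod (2 ^ k)) = 2 ^ (k - 1) := by
  rw [neg_eq_iff_add_eq_zero, ← two_mul]
  rcases k with _ | k
  · exact Subsingleton.elim (α := ZMod 1) _ _
  · have h := ZMod.natCast_self (2 ^ (k + 1))
    push_cast at h
    rw [Nat.add_sub_cancel, ← pow_succ', h]

theorem centralElt_comm (l k : ℕ) (g : SemiProd l k) :
    g * centralElt l k = centralElt l k * g := by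
  have key (x : ZMod 4) : (-1 : ℤ) ^ x.val • ((0, 2 ^ (k - 1)) : (Fin l → ℤ) × ZMod (2 ^ k)) =
      (0, 2 ^ (k - 1)) := by
    rcases neg_one_pow_eq_or ℤ x.val with h | h <;> rw [h]
    · simp
    · rw [neg_one_smul, Prod.neg_mk, neg_zero, neg_two_pow_pred]
  apply SemidirectProduct.ext
  · change Multiplicative.ofAdd (g.left.toAdd + (-1 : ℤ) ^ (g.right.toAdd).val • (0, 2 ^ (k - 1))) =
      .ofAdd ((0, 2 ^ (k - 1)) + (-1 : ℤ) ^ (2 : ZMod 4).val • g.left.toAdd)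
    rw [key, show (-1 : ℤ) ^ (2 : ZMod 4).val = 1 by decide, one_smul, add_comm]
  · exact mul_comm g.right (.ofAdd 2)

/-- The subgroup generated by `(2, 2^{k-1})`. -/
abbrev centralSubgroup (l k : ℕ) : Subgroup (SemiProd l k) :=
  Subgroup.zpowers (centralElt l k)

instance centralSubgroup_normal (l k : ℕ) : (centralSubgroup l k).Normal where
  conj_mem a ha g := by
    obtain ⟨i, rfl⟩ := Subgroup.mem_zpowers_iff.mp ha
    have h : Commute g (centralElt l k ^ i) :=
      (show Commute g (centralElt l k) from centralElt_comm l k g).zpow_right i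
    rw [h.eq, mul_inv_cancel_right]
    exact ha

/-- The group `(ℤ₄ ⋉ (ℤ^l ⊕ ℤ_{2^k})) / ⟨(2, 2^{k-1})⟩`, meaningful for `k ≥ 1`. -/
abbrev LimitModel (l k : ℕ) : Type := SemiProd l k ⧸ centralSubgroup l k

/-! ### Universal theories -/

/-- The function symbols of the language of groups. -/
inductive GroupFunc : ℕ → Type
  | one : GroupFunc 0
  | inv : GroupFunc 1
  | mul : GroupFunc 2

/-- The first order language `(1, ⁻¹, ·)` of groups. -/
def groupLanguage : Language := ⟨GroupFunc, fun _ => Empty⟩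

/-- A group as a structure in the language of groups. -/
instance groupStructure (G : Type*) [Group G] : groupLanguage.Structure G where
  funMap {_} f v :=
    match f, v with
    | .one, _ => 1
    | .inv, v => (v 0)⁻¹
    | .mul, v => v 0 * v 1
  RelMap {_} r _ := Empty.elim r

/-- The universal theory of `G`: the sentences `∀ x₁ … ∀ xᵣ, φ` with `φ` quantifier-free that are
true in `G`. -/
def universalTheory (G : Type*) [Group G] : Set groupLanguage.Sentence :=
  {φ | Language.BoundedFormula.IsUniversal φ ∧ G ⊨ φ}

/-! ### Ultraproducts -/

/-- The congruence `x ∼ y ↔ {i | x i = y i} ∈ 𝒰` on `∏ᵢ H i`. -/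
def ultraCon (𝒰 : Ultrafilter ℕ) (H : ℕ → Type) [∀ i, Group (H i)] : Con (∀ i, H i) where
  r x y := {i | x i = y i} ∈ 𝒰
  iseqv :=
    { refl := fun x => Filter.Eventually.of_forall (f := (𝒰 : Filter ℕ)) fun _ => rfl
      symm := fun {x y} h => by simpa only [eq_comm] using h
      trans := fun {x y z} h₁ h₂ => by
        filter_upwards [h₁, h₂] with i h h' using h.trans h' }
  mul' := fun {w x y z} h₁ h₂ => by
    change _ ∈ 𝒰
    filter_upwards [h₁, h₂] with i h h'
    exact congrArg₂ (· * ·) h h'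

/-- The ultraproduct `∏ᵢ H i / 𝒰`, with its quotient group structure. -/
abbrev Ultraproduct (𝒰 : Ultrafilter ℕ) (H : ℕ → Type) [∀ i, Group (H i)] : Type :=
  (ultraCon 𝒰 H).Quotient

/-- `G` embeds in an ultraproduct of a sequence of groups in the class `X`. -/
def EmbedsInUltraproductOf (X : (H : Type) → [Group H] → Prop) (G : Type*) [Group G] : Prop :=
  ∃ (H : ℕ → Type) (_ : ∀ i, Group (H i)) (𝒰 : Ultrafilter ℕ),
    (∀ i, X (H i)) ∧ ∃ f : G →* Ultraproduct 𝒰 H, Function.Injective f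

end QuaternionLimits

/-!
The conditions are proved equivalent along the cycle: limit of quaternion groups → subgroup of an
ultraproduct → model group → fully residually quaternion → containment of universal theories → limit
of quaternion groups.

For the first step, evaluating words along the sequence embeds `G` in the ultraproduct over a
nonprincipal ultrafilter (`IsLimitOf.embedsInUltraproductOf`).

The classification of the subgroups of ultraproducts is the structural step. A generalized
quaternion group has a cyclic subgroup `A` of index two, inverted by every element outside `A`, and
the square of such an element is the unique involution of `A`; moreover `A` has no odd torsion.
These properties (`IsQuaternionLike`) are inherited by ultraproducts and by subgroups, so `G` has
such a subgroup `A`. It is finitely generated and abelian, hence `A ≅ ℤ^l ⊕ ℤ_{2^k}` by the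
uniqueness of the involution (`exists_addEquiv_of_unique_involution`), and the action and the square
of an element outside `A` determine `G` (`IsQuaternionLike.exists_mulEquiv_limitModel`). When `G` is
finite, then `l = 0` and `G` is a quaternion group; in particular nonabelian subgroups of quaternion
groups are quaternion groups (`IsQuaternion.subgroup`).

That the model groups are fully residually quaternion holds because a suitable homomorphism `ℤ^l ⊕
ℤ_{2^k} → ℤ_{2^N}`, injective on a given finite set, extends to the model group
(`fullyResidually_limitModel`).

If `G` is fully residually quaternion, the failure of a universal sentence in `G` involves finitely
many elements of `G`, so it persists under a homomorphism that is injective on them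
(`FullyResidually.universalTheory_subset`).

If universal sentences pass to `G`, every finite part of the diagram of a marking of `G` is realized
in a quaternion group, since otherwise the negation would be a universal sentence that holds in all
quaternion groups but not in `G`. The subgroups generated by the realizing tuples converge to `G`,
and they are quaternion groups because they are not abelian (`isLimitOf_of_universalTheory_subset`).
-/

namespace QuaternionLimits

/-! ### Groups that look like quaternion groups -/

/-- The first order properties of the cyclic subgroup `A` of index two in a generalized quaternion
group `H` that determine the structure of `H`. It is not required that `A ≠ ⊤`. -/
structure IsQuaternionLike {H : Type*} [Group H] (A : Subgroup H) : Prop where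
  mul_comm : ∀ a ∈ A, ∀ b ∈ A, a * b = b * a
  conj : ∀ a ∈ A, ∀ g ∉ A, g * a * g⁻¹ = a⁻¹
  mul_mem : ∀ g ∉ A, ∀ h ∉ A, g * h ∈ A
  sq_ne : ∀ g ∉ A, g ^ 2 ≠ 1
  sq_sq : ∀ g ∉ A, (g ^ 2) ^ 2 = 1
  invol : ∀ a ∈ A, ∀ b ∈ A, a ^ 2 = 1 → b ^ 2 = 1 → a ≠ 1 → b ≠ 1 → a = b
  odd : ∀ a ∈ A, ∀ n : ℕ, Odd n → a ^ n = 1 → a = 1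

theorem IsQuaternionLike.comap {G H : Type*} [Group G] [Group H] {A : Subgroup H}
    (hA : IsQuaternionLike A) {f : G →* H} (hf : Function.Injective f) :
    IsQuaternionLike (A.comap f) where
  mul_comm a ha b hb := hf (by simpa using hA.mul_comm _ ha _ hb)
  conj a ha g hg := hf (by simpa using hA.conj _ ha _ hg)
  mul_mem g hg h hh := by simpa using hA.mul_mem _ hg _ hh
  sq_ne g hg h := hA.sq_ne _ hg (by rw [← map_pow, h, map_one])
  sq_sq g hg := hf (by simpa using hA.sq_sq _ hg)
  invol a ha b hb h h' h₁ h₁' := hf (hA.invol _ ha _ hb (by rw [← map_pow, h, map_one])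
    (by rw [← map_pow, h', map_one]) (by simpa using hf.ne h₁) (by simpa using hf.ne h₁'))
  odd a ha n hn h := hf (by
    rw [map_one]; exact hA.odd _ ha n hn (by rw [← map_pow, h, map_one]))

/-- The cyclic subgroup of index two in `QuaternionGroup m`. -/
def rotations (m : ℕ) : Subgroup (QuaternionGroup m) where
  carrier := Set.range QuaternionGroup.a
  mul_mem' := by
    rintro _ _ ⟨i, rfl⟩ ⟨j, rfl⟩
    exact ⟨i + j, rfl⟩
  one_mem' := ⟨0, rfl⟩
  inv_mem' := by
    rintro _ ⟨i, rfl⟩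
    exact ⟨-i, rfl⟩

theorem a_mem_rotations {m : ℕ} (i : ZMod (2 * m)) : QuaternionGroup.a i ∈ rotations m :=
  ⟨i, rfl⟩

theorem a_pow {m : ℕ} (i : ZMod (2 * m)) (n : ℕ) :
    QuaternionGroup.a i ^ n = QuaternionGroup.a ((n : ZMod (2 * m)) * i) := by
  induction n with
  | zero => simp
  | succ n ih => rw [pow_succ, ih, QuaternionGroup.a_mul_a]; congr 1; push_cast; ring

theorem a_eq_one_iff {m : ℕ} {i : ZMod (2 * m)} : QuaternionGroup.a i = 1 ↔ i = 0 := by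
  rw [QuaternionGroup.one_def, QuaternionGroup.a.injEq]

/-- In `ℤ/2m` the element `m` is of order two. -/
theorem natCast_half_add_self (m : ℕ) : (m : ZMod (2 * m)) + m = 0 := by
  have h := ZMod.natCast_self (2 * m)
  rw [Nat.cast_mul, Nat.cast_two] at h
  rw [← two_mul, h]

theorem natCast_half_ne_zero {m : ℕ} (hm : m ≠ 0) : (m : ZMod (2 * m)) ≠ 0 := by
  rw [Ne, ZMod.natCast_eq_zero_iff]
  intro h
  have := Nat.le_of_dvd (by omega) h
  omega

theorem eq_half_of_add_self_eq_zero {m : ℕ} (hm : m ≠ 0) {i : ZMod (2 * m)} (h : i + i = 0)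
    (hi : i ≠ 0) : i = m := by
  have : NeZero (2 * m) := ⟨by omega⟩
  have hlt := ZMod.val_lt i
  have hdvd : 2 * m ∣ 2 * i.val := by
    rw [← ZMod.natCast_eq_zero_iff, two_mul i.val, Nat.cast_add, ZMod.natCast_zmod_val, h]
  obtain ⟨c, hc⟩ := Nat.dvd_of_mul_dvd_mul_left two_pos hdvd
  have hc2 : c < 2 := by
    by_contra! hc2
    nlinarith
  have hc0 : c ≠ 0 := by
    rintro rfl
    exact hi ((ZMod.val_eq_zero i).mp (by simpa using hc))
  obtain rfl : c = 1 := by omega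
  rw [← ZMod.natCast_zmod_val i, hc, mul_one]

theorem isQuaternionLike_rotations (j : ℕ) : IsQuaternionLike (rotations (2 ^ j)) where
  mul_comm := by
    rintro _ ⟨i, rfl⟩ _ ⟨j, rfl⟩
    rw [QuaternionGroup.a_mul_a, QuaternionGroup.a_mul_a, add_comm]
  conj := by
    rintro _ ⟨i, rfl⟩ (g | g) hg
    · exact (hg (a_mem_rotations g)).elim
    · rw [mul_inv_eq_iff_eq_mul, QuaternionGroup.xa_mul_a]
      change _ = QuaternionGroup.a (-i) * _
      rw [QuaternionGroup.a_mul_xa, sub_neg_eq_add]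
  mul_mem := by
    rintro (g | g) hg (h | h) hh
    · exact (hg (a_mem_rotations g)).elim
    · exact (hg (a_mem_rotations g)).elim
    · exact (hh (a_mem_rotations h)).elim
    · exact ⟨_, rfl⟩
  sq_ne := by
    rintro (g | g) hg
    · exact (hg (a_mem_rotations g)).elim
    · rw [QuaternionGroup.xa_sq, Ne, a_eq_one_iff]
      exact natCast_half_ne_zero (by positivity)
  sq_sq := by
    rintro (g | g) hg
    · exact (hg (a_mem_rotations g)).elim
    · rw [QuaternionGroup.xa_sq, sq, QuaternionGroup.a_mul_a, natCast_half_add_self]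
      rfl
  invol := by
    rintro _ ⟨i, rfl⟩ _ ⟨j, rfl⟩ hi hj hi' hj'
    rw [sq, QuaternionGroup.a_mul_a, a_eq_one_iff] at hi hj
    rw [Ne, a_eq_one_iff] at hi' hj'
    rw [eq_half_of_add_self_eq_zero (by positivity) hi hi',
      eq_half_of_add_self_eq_zero (by positivity) hj hj']
  odd := by
    rintro _ ⟨i, rfl⟩ n hn h
    rw [a_pow, a_eq_one_iff] at h
    have hu : IsUnit (n : ZMod (2 * 2 ^ j)) := by
      rw [ZMod.isUnit_iff_coprime, ← pow_succ']
      exact (Nat.coprime_two_right.mpr hn).pow_right _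
    rw [a_eq_one_iff, ← hu.mul_right_eq_zero, h]

theorem IsQuaternion.exists_isQuaternionLike {H : Type} [Group H] (h : IsQuaternion H) :
    ∃ A : Subgroup H, IsQuaternionLike A := by
  obtain ⟨n, -, ⟨e⟩⟩ := h
  exact ⟨_, (isQuaternionLike_rotations (n - 2)).comap (f := e.toMonoidHom) e.injective⟩

/-! ### Passing to ultraproducts -/

section Ultraproduct

variable {𝒰 : Ultrafilter ℕ} {H : ℕ → Type} [∀ i, Group (H i)]

theorem ultraproduct_eq_iff {x y : ∀ i, H i} :
    (x : Ultraproduct 𝒰 H) = y ↔ ∀ᶠ i in 𝒰, x i = y i :=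
  Con.eq _

variable (𝒰) in
/-- The ultraproduct of a sequence of subgroups. -/
def ultraSubgroup (A : ∀ i, Subgroup (H i)) : Subgroup (Ultraproduct 𝒰 H) where
  carrier := {q | ∃ x : ∀ i, H i, (x : Ultraproduct 𝒰 H) = q ∧ ∀ᶠ i in 𝒰, x i ∈ A i}
  mul_mem' := by
    rintro _ _ ⟨x, rfl, hx⟩ ⟨y, rfl, hy⟩
    exact ⟨x * y, rfl, by filter_upwards [hx, hy] with i h h' using mul_mem h h'⟩
  one_mem' := ⟨1, rfl, .of_forall fun i => one_mem _⟩
  inv_mem' := by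
    rintro _ ⟨x, rfl, hx⟩
    exact ⟨x⁻¹, rfl, by filter_upwards [hx] with i h using inv_mem h⟩

theorem coe_mem_ultraSubgroup {A : ∀ i, Subgroup (H i)} {x : ∀ i, H i} :
    (x : Ultraproduct 𝒰 H) ∈ ultraSubgroup 𝒰 A ↔ ∀ᶠ i in 𝒰, x i ∈ A i := by
  refine ⟨?_, fun h => ⟨x, rfl, h⟩⟩
  rintro ⟨y, hy, h⟩
  filter_upwards [ultraproduct_eq_iff.mp hy, h] with i h₁ h₂
  rwa [← h₁]

theorem coe_notMem_ultraSubgroup {A : ∀ i, Subgroup (H i)} {x : ∀ i, H i} :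
    (x : Ultraproduct 𝒰 H) ∉ ultraSubgroup 𝒰 A ↔ ∀ᶠ i in 𝒰, x i ∉ A i := by
  rw [coe_mem_ultraSubgroup, Ultrafilter.eventually_not]

theorem coe_ne_iff {x y : ∀ i, H i} :
    (x : Ultraproduct 𝒰 H) ≠ y ↔ ∀ᶠ i in 𝒰, x i ≠ y i := by
  rw [Ne, ultraproduct_eq_iff, Ultrafilter.eventually_not]

theorem IsQuaternionLike.ultraproduct {A : ∀ i, Subgroup (H i)}
    (hA : ∀ i, IsQuaternionLike (A i)) : IsQuaternionLike (ultraSubgroup 𝒰 A) where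
  mul_comm a ha b hb := by
    induction a using Con.induction_on with | H a => ?_
    induction b using Con.induction_on with | H b => ?_
    refine ultraproduct_eq_iff (x := a * b) (y := b * a) |>.mpr ?_
    filter_upwards [coe_mem_ultraSubgroup.mp ha, coe_mem_ultraSubgroup.mp hb] with i h h'
    exact (hA i).mul_comm _ h _ h'
  conj a ha g hg := by
    induction a using Con.induction_on with | H a => ?_
    induction g using Con.induction_on with | H g => ?_
    refine ultraproduct_eq_iff (x := g * a * g⁻¹) (y := a⁻¹) |>.mpr ?_
    filter_upwards [coe_mem_ultraSubgroup.mp ha, coe_notMem_ultraSubgroup.mp hg] with i h h'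
    exact (hA i).conj _ h _ h'
  mul_mem g hg h hh := by
    induction g using Con.induction_on with | H g => ?_
    induction h using Con.induction_on with | H h => ?_
    refine coe_mem_ultraSubgroup (x := g * h) |>.mpr ?_
    filter_upwards [coe_notMem_ultraSubgroup.mp hg, coe_notMem_ultraSubgroup.mp hh] with i h h'
    exact (hA i).mul_mem _ h _ h'
  sq_ne g hg := by
    induction g using Con.induction_on with | H g => ?_
    refine coe_ne_iff (x := g ^ 2) (y := 1) |>.mpr ?_
    filter_upwards [coe_notMem_ultraSubgroup.mp hg] with i h
    exact (hA i).sq_ne _ h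
  sq_sq g hg := by
    induction g using Con.induction_on with | H g => ?_
    refine ultraproduct_eq_iff (x := (g ^ 2) ^ 2) (y := 1) |>.mpr ?_
    filter_upwards [coe_notMem_ultraSubgroup.mp hg] with i h
    exact (hA i).sq_sq _ h
  invol a ha b hb h₁ h₂ h₃ h₄ := by
    induction a using Con.induction_on with | H a => ?_
    induction b using Con.induction_on with | H b => ?_
    refine ultraproduct_eq_iff.mpr ?_
    filter_upwards [coe_mem_ultraSubgroup.mp ha, coe_mem_ultraSubgroup.mp hb,
      ultraproduct_eq_iff (x := a ^ 2) (y := 1) |>.mp h₁,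
      ultraproduct_eq_iff (x := b ^ 2) (y := 1) |>.mp h₂,
      coe_ne_iff (y := 1) |>.mp h₃, coe_ne_iff (y := 1) |>.mp h₄] with i h h' g₁ g₂ g₃ g₄
    exact (hA i).invol _ h _ h' g₁ g₂ g₃ g₄
  odd a ha n hn h := by
    induction a using Con.induction_on with | H a => ?_
    refine ultraproduct_eq_iff (y := 1) |>.mpr ?_
    filter_upwards [coe_mem_ultraSubgroup.mp ha,
      ultraproduct_eq_iff (x := a ^ n) (y := 1) |>.mp h] with i h₁ h₂
    exact (hA i).odd _ h₁ n hn h₂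

theorem EmbedsInUltraproductOf.exists_isQuaternionLike {G : Type*} [Group G]
    (h : EmbedsInUltraproductOf IsQuaternion G) : ∃ A : Subgroup G, IsQuaternionLike A := by
  obtain ⟨H, _, 𝒰, hH, f, hf⟩ := h
  choose A hA using fun i => (hH i).exists_isQuaternionLike
  exact ⟨_, (IsQuaternionLike.ultraproduct hA).comap hf⟩

end Ultraproduct

/-! ### Finitely generated abelian groups with a unique involution -/

theorem prime_pow_pred_ne_zero {p k : ℕ} (hp : p.Prime) (hk : 1 ≤ k) :
    ((p ^ (k - 1) : ℕ) : ZMod (p ^ k)) ≠ 0 := by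
  rw [Ne, ZMod.natCast_eq_zero_iff, Nat.pow_dvd_pow_iff_le_right hp.one_lt]
  omega

open DirectSum in
/-- A finitely generated abelian group without odd torsion and with exactly one involution has a
cyclic torsion subgroup, because every nontrivial cyclic summand contributes an involution. -/
theorem exists_addEquiv_of_unique_involution {B : Type*} [AddCommGroup B] [AddGroup.FG B]
    (hodd : ∀ b : B, ∀ n : ℕ, Odd n → n • b = 0 → b = 0)
    (hinv : ∀ a b : B, 2 • a = 0 → 2 • b = 0 → a ≠ 0 → b ≠ 0 → a = b)
    {z : B} (hz : 2 • z = 0) (hz0 : z ≠ 0) :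
    ∃ l k : ℕ, 1 ≤ k ∧ Nonempty (B ≃+ (Fin l → ℤ) × ZMod (2 ^ k)) := by
  classical
  obtain ⟨l, ι, _, p, hp, e, ⟨f⟩⟩ := AddCommGroup.equiv_free_prod_directSum_zmod B
  -- the element of order `p i` in the `i`-th summand
  let u (i : ι) : B :=
    f.symm (0, DirectSum.of (fun i => ZMod (p i ^ e i)) i ((p i ^ (e i - 1) : ℕ) : ZMod _))
  have hfu (i : ι) : (f (u i)).2 i = ((p i ^ (e i - 1) : ℕ) : ZMod (p i ^ e i)) := by
    simp only [u, AddEquiv.apply_symm_apply, DirectSum.of_eq_same]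
  have hfu' {i j : ι} (hij : i ≠ j) : (f (u i)).2 j = 0 := by
    simp only [u, AddEquiv.apply_symm_apply]
    exact DirectSum.of_eq_of_ne _ _ _ hij.symm
  have hu0 {i : ι} (hi : 1 ≤ e i) : u i ≠ 0 := by
    intro h
    have := hfu i
    rw [h, map_zero] at this
    exact prime_pow_pred_ne_zero (hp i) hi this.symm
  have hpu {i : ι} (hi : 1 ≤ e i) : p i • u i = 0 := by
    simp only [u]
    rw [← map_nsmul, Prod.smul_mk, smul_zero, ← map_nsmul, nsmul_eq_mul, ← Nat.cast_mul,
      ← pow_succ', Nat.sub_add_cancel hi, ZMod.natCast_self, map_zero, ← Prod.zero_eq_mk, map_zero]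
  have hp2 {i : ι} (hi : 1 ≤ e i) : p i = 2 := by
    by_contra h
    exact hu0 hi (hodd _ _ ((hp i).odd_of_ne_two h) (hpu hi))
  have huniq {i j : ι} (hi : 1 ≤ e i) (hj : 1 ≤ e j) : i = j := by
    by_contra hij
    have h := hinv (u i) (u j) (by rw [← hpu hi, hp2 hi]) (by rw [← hpu hj, hp2 hj])
      (hu0 hi) (hu0 hj)
    have h' := hfu i
    rw [h, hfu' (Ne.symm hij)] at h'
    exact prime_pow_pred_ne_zero (hp i) hi h'.symm
  have hsub {j : ι} (hj : ¬ 1 ≤ e j) (x y : ZMod (p j ^ e j)) : x = y := by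
    have hj0 : p j ^ e j = 1 := by rw [show e j = 0 by omega, pow_zero]
    have : Subsingleton (ZMod (p j ^ e j)) := by
      rw [hj0]
      exact inferInstanceAs (Subsingleton (Fin 1))
    exact Subsingleton.elim _ _
  obtain ⟨i, hi⟩ : ∃ i, 1 ≤ e i := by
    by_contra! h
    refine hz0 (f.injective ?_)
    rw [map_zero]
    refine Prod.ext ?_ (DFinsupp.ext fun j => hsub (by have := h j; omega) _ _)
    have h2 : 2 • (f z).1 = 0 := by rw [← Prod.smul_fst, ← map_nsmul, hz, map_zero]; rfl
    ext j
    have := DFunLike.congr_fun h2 j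
    simpa using this
  have hbij : Function.Bijective (DirectSum.of (fun i => ZMod (p i ^ e i)) i) := by
    refine ⟨DirectSum.of_injective i, fun x => ⟨x i, DFinsupp.ext fun j => ?_⟩⟩
    by_cases hj : 1 ≤ e j
    · obtain rfl := huniq hi hj
      exact DirectSum.of_eq_same _ _
    · exact hsub hj _ _
  refine ⟨l, e i, hi, ⟨f.trans (AddEquiv.prodCongr ?_ ?_)⟩⟩
  · exact (Finsupp.linearEquivFunOnFinite ℤ ℤ (Fin l)).toAddEquiv
  · exact (AddEquiv.ofBijective _ hbij).symm.trans
      (ZMod.ringEquivCongr (by rw [hp2 hi])).toAddEquiv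

/-! ### Homomorphisms out of the model groups -/

section ModelHom

variable {l k : ℕ}

/-- Modulo the central element, the component in `ℤ₄` is `0` or `1`. -/
theorem LimitModel.exists_rep (q : LimitModel l k) :
    ∃ a : (Fin l → ℤ) × ZMod (2 ^ k),
      q = ((⟨.ofAdd a, .ofAdd 0⟩ : SemiProd l k) : LimitModel l k) ∨
      q = ((⟨.ofAdd a, .ofAdd 1⟩ : SemiProd l k) : LimitModel l k) := by
  obtain ⟨⟨a, x⟩, rfl⟩ := QuotientGroup.mk_surjective q
  -- the central element moves the component in `ℤ₄` by two
  have key : ((⟨a, x⟩ : SemiProd l k) : LimitModel l k) =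
      ((centralElt l k * ⟨a, x⟩ : SemiProd l k) : LimitModel l k) := by
    rw [← centralElt_comm, QuotientGroup.eq, inv_mul_cancel_left]
    exact Subgroup.mem_zpowers _
  have h4 : ∀ x : ZMod 4, (x = 0 ∨ x = 1) ∨ (2 + x = 0 ∨ 2 + x = 1) := by decide
  rcases h4 x.toAdd with h | h
  · refine ⟨a.toAdd, h.imp ?_ ?_⟩ <;> intro h <;> rw [← h] <;> rfl
  · refine ⟨(centralElt l k * ⟨a, x⟩).left.toAdd, h.imp ?_ ?_⟩ <;> intro h <;> rw [key, ← h] <;> rfl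

variable {K : Type*} [Group K] (e : Multiplicative ((Fin l → ℤ) × ZMod (2 ^ k)) →* K) (g : K)

/-- The homomorphism from `ℤ₄` that maps the generator to `g`. -/
def zmodFourHom (hg : g ^ 4 = 1) : Multiplicative (ZMod 4) →* K where
  toFun x := g ^ x.toAdd.val
  map_one' := by simp
  map_mul' x y := by
    rw [toAdd_mul, ZMod.val_add, ← pow_eq_pow_mod _ hg, pow_add]

theorem pow_conj_eq (hconj : ∀ a, g * e a * g⁻¹ = e a⁻¹)
    (a : Multiplicative ((Fin l → ℤ) × ZMod (2 ^ k))) (n : ℕ) :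
    e (.ofAdd ((-1 : ℤ) ^ n • a.toAdd)) = g ^ n * e a * (g ^ n)⁻¹ := by
  induction n with
  | zero => simp
  | succ n ih =>
    have h := hconj (.ofAdd ((-1 : ℤ) ^ n • a.toAdd))
    rw [ih] at h
    rw [pow_succ', mul_smul, neg_one_smul, ofAdd_neg, ← h, pow_succ']
    group

variable (l k) in
/-- The homomorphism from the model group that is given by `e` on `ℤ^l ⊕ ℤ_{2^k}` and maps the
generator of `ℤ₄` to `g`. -/
def modelHom (hconj : ∀ a, g * e a * g⁻¹ = e a⁻¹) (hg : g ^ 4 = 1)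
    (hc : e (.ofAdd (0, 2 ^ (k - 1))) = g ^ 2) : LimitModel l k →* K :=
  QuotientGroup.lift (centralSubgroup l k)
    (SemidirectProduct.lift e (zmodFourHom g hg) fun x => by
      refine MonoidHom.ext fun a => ?_
      exact pow_conj_eq e g hconj a _)
    (by
      rw [Subgroup.zpowers_le, MonoidHom.mem_ker]
      change e (.ofAdd (0, 2 ^ (k - 1))) * g ^ 2 = 1
      rw [hc, ← pow_add, hg])

variable (hconj : ∀ a, g * e a * g⁻¹ = e a⁻¹) (hg : g ^ 4 = 1)
  (hc : e (.ofAdd (0, 2 ^ (k - 1))) = g ^ 2)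

theorem modelHom_mk (a : (Fin l → ℤ) × ZMod (2 ^ k)) (x : ZMod 4) :
    modelHom l k e g hconj hg hc ((⟨.ofAdd a, .ofAdd x⟩ : SemiProd l k) : LimitModel l k) =
      e (.ofAdd a) * g ^ x.val :=
  rfl

theorem modelHom_injective (he : Function.Injective e) (hg' : ∀ a, e a * g ≠ 1) :
    Function.Injective (modelHom l k e g hconj hg hc) := by
  rw [injective_iff_map_eq_one]
  intro q hq
  obtain ⟨a, rfl | rfl⟩ := q.exists_rep
  · rw [modelHom_mk, ZMod.val_zero, pow_zero, mul_one] at hq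
    obtain rfl : a = 0 := Multiplicative.ofAdd.injective (he (hq.trans (map_one e).symm))
    rfl
  · rw [modelHom_mk, show (1 : ZMod 4).val = 1 from rfl, pow_one] at hq
    exact (hg' _ hq).elim

theorem modelHom_surjective (he : ∀ h, (∃ a, e a = h) ∨ ∃ a, e a * g = h) :
    Function.Surjective (modelHom l k e g hconj hg hc) := by
  intro h
  rcases he h with ⟨a, rfl⟩ | ⟨a, rfl⟩
  · refine ⟨((⟨.ofAdd a.toAdd, .ofAdd 0⟩ : SemiProd l k) : LimitModel l k), ?_⟩
    rw [modelHom_mk, ZMod.val_zero, pow_zero, mul_one, ofAdd_toAdd]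
  · refine ⟨((⟨.ofAdd a.toAdd, .ofAdd 1⟩ : SemiProd l k) : LimitModel l k), ?_⟩
    rw [modelHom_mk, show (1 : ZMod 4).val = 1 from rfl, pow_one, ofAdd_toAdd]

end ModelHom

/-! ### Structure of the finitely generated groups that look like quaternion groups -/

/-- The classification: conjugation by an element `g ∉ A` inverts `A`, the square `g ^ 2` is the
unique involution of `A`, and `A` has index two, hence is finitely generated. -/
theorem IsQuaternionLike.exists_mulEquiv_limitModel {G : Type*} [Group G] [Group.FG G]
    (hG : ¬ ∀ a b : G, a * b = b * a) {A : Subgroup G} (hA : IsQuaternionLike A) :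
    ∃ l k : ℕ, 1 ≤ k ∧ Nonempty (G ≃* LimitModel l k) := by
  obtain ⟨g, hg⟩ : ∃ g, g ∉ A := by
    by_contra! h
    exact hG fun a b => hA.mul_comm a (h a) b (h b)
  have hindex : A.index = 2 := by
    rw [Subgroup.index_eq_two_iff_exists_notMem_and]
    refine ⟨g, hg, fun b => ?_⟩
    by_cases hb : b ∈ A
    · exact .inr hb
    · exact .inl (hA.mul_mem b hb g hg)
  have : A.FiniteIndex := ⟨by omega⟩
  let _ : CommGroup A :=
    { (inferInstance : Group A) with
      mul_comm := fun a b => Subtype.ext (hA.mul_comm a a.2 b b.2) }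
  have hsq : g ^ 2 ∈ A := by rw [sq]; exact hA.mul_mem g hg g hg
  have hz0 : (⟨g ^ 2, hsq⟩ : A) ≠ 1 := fun h => hA.sq_ne g hg (congrArg Subtype.val h)
  have hz2 : (⟨g ^ 2, hsq⟩ : A) ^ 2 = 1 := Subtype.ext (hA.sq_sq g hg)
  have hinv (a b : A) (ha : a ^ 2 = 1) (hb : b ^ 2 = 1) (ha1 : a ≠ 1) (hb1 : b ≠ 1) : a = b :=
    Subtype.ext (hA.invol a a.2 b b.2 (congrArg Subtype.val ha) (congrArg Subtype.val hb)
      (fun h => ha1 (Subtype.ext h)) (fun h => hb1 (Subtype.ext h)))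
  have hodd (a : A) (n : ℕ) (hn : Odd n) (h : a ^ n = 1) : a = 1 :=
    Subtype.ext (hA.odd a a.2 n hn (congrArg Subtype.val h))
  obtain ⟨l, k, hk, ⟨f⟩⟩ := exists_addEquiv_of_unique_involution (B := Additive A)
    (z := .ofMul ⟨g ^ 2, hsq⟩) hodd hinv hz2 hz0
  refine ⟨l, k, hk, ⟨?_⟩⟩
  let e : Multiplicative ((Fin l → ℤ) × ZMod (2 ^ k)) →* G :=
    A.subtype.comp (AddMonoidHom.toMultiplicativeLeft f.symm.toAddMonoidHom)
  have he_mem (a) : e a ∈ A := Subtype.property _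
  have he_inj : Function.Injective e := fun a b h => f.symm.injective (Subtype.ext h)
  have he_surj {h : G} (hh : h ∈ A) : ∃ a, e a = h :=
    ⟨.ofAdd (f (.ofMul ⟨h, hh⟩)), congrArg Subtype.val (f.symm_apply_apply (.ofMul ⟨h, hh⟩))⟩
  have hc : e (.ofAdd (0, 2 ^ (k - 1))) = g ^ 2 := by
    have h0 : (2 ^ (k - 1) : ZMod (2 ^ k)) ≠ 0 := by
      exact_mod_cast prime_pow_pred_ne_zero Nat.prime_two hk
    refine hA.invol _ (he_mem _) _ hsq ?_ (hA.sq_sq g hg) ?_ (hA.sq_ne g hg)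
    · rw [← map_pow, ← ofAdd_nsmul, Prod.smul_mk, smul_zero, two_nsmul,
        eq_neg_iff_add_eq_zero.mp (neg_two_pow_pred k).symm]
      exact map_one e
    · intro h
      have := Multiplicative.ofAdd.injective (he_inj (h.trans (map_one e).symm))
      exact h0 (congrArg Prod.snd this)
  have hginv : g⁻¹ ∉ A := by rwa [inv_mem_iff]
  have hconj (a) : g * e a * g⁻¹ = e a⁻¹ := by rw [hA.conj _ (he_mem a) g hg, map_inv]
  have hg4 : g ^ 4 = 1 := by rw [← hA.sq_sq g hg, ← pow_mul]
  refine (MulEquiv.ofBijective (modelHom l k e g hconj hg4 hc)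
    ⟨modelHom_injective _ _ _ _ _ he_inj fun a h => hg ?_,
      modelHom_surjective _ _ _ _ _ fun h => ?_⟩).symm
  · rw [← inv_inv g, inv_mem_iff, ← eq_inv_of_mul_eq_one_left h]
    exact he_mem a
  · by_cases hh : h ∈ A
    · exact .inl (he_surj hh)
    · obtain ⟨a, ha⟩ := he_surj (hA.mul_mem h hh _ hginv)
      exact .inr ⟨a, by rw [ha, inv_mul_cancel_right]⟩

/-! ### Homomorphisms from the model groups to quaternion groups -/

/-- Finitely many nonzero vectors of `ℤ^l` are avoided by the kernel of some linear form, namely by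
`v ↦ ∑ᵢ vᵢ tⁱ` for an integer `t` that is not a root of the corresponding polynomials. -/
theorem exists_linearForm_ne_zero {l : ℕ} (D : Finset (Fin l → ℤ)) :
    ∃ f : (Fin l → ℤ) →+ ℤ, ∀ v ∈ D, f v = 0 → v = 0 := by
  classical
  let P (v : Fin l → ℤ) : Polynomial ℤ := ∑ i, Polynomial.C (v i) * Polynomial.X ^ (i : ℕ)
  have hP (v : Fin l → ℤ) (hv : v ≠ 0) : P v ≠ 0 := by
    intro h
    refine hv (funext fun i => ?_)
    have := congrArg (fun p => Polynomial.coeff p i) h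
    simpa [P, Polynomial.finsetSum_coeff, Polynomial.coeff_X_pow, Fin.val_inj] using this
  have hprod : ∏ v ∈ D with v ≠ 0, P v ≠ 0 :=
    Finset.prod_ne_zero_iff.mpr fun v hv => hP v (Finset.mem_filter.mp hv).2
  obtain ⟨t, ht⟩ : ∃ t : ℤ, (∏ v ∈ D with v ≠ 0, P v).eval t ≠ 0 := by
    by_contra! h
    exact hprod (Polynomial.funext fun r => by rw [h, Polynomial.eval_zero])
  refine ⟨{ toFun := fun v => (P v).eval t, map_zero' := ?_, map_add' := ?_ }, fun v hv h => ?_⟩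
  · simp [P]
  · intro v w
    simp [P, add_mul, Finset.sum_add_distrib]
  · by_contra hv0
    rw [Polynomial.eval_prod, Finset.prod_ne_zero_iff] at ht
    exact ht v (Finset.mem_filter.mpr ⟨hv, hv0⟩) h

/-- The homomorphism `(v, c) ↦ f v + 2^j c` from `ℤ^l ⊕ ℤ_{2^k}` to `ℤ_{2^(j+k)}`. The modulus is a
variable, because it occurs as `2 * 2^(j+k-1)` in `QuaternionGroup (2^(j+k-1))`. -/
theorem exists_addMonoidHom_zmod {l : ℕ} (f : (Fin l → ℤ) →+ ℤ) {j k M : ℕ}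
    (hM : M = 2 ^ j * 2 ^ k) :
    ∃ φ : (Fin l → ℤ) × ZMod (2 ^ k) →+ ZMod M,
      ∀ v (c : ℤ), φ (v, (c : ZMod (2 ^ k))) = ((f v + 2 ^ j * c : ℤ) : ZMod M) := by
  have h : zmultiplesHom (ZMod M) (2 ^ j) ((2 ^ k : ℕ) : ℤ) = 0 := by
    have := ZMod.natCast_self M
    rw [zmultiplesHom_apply, natCast_zsmul, nsmul_eq_mul, mul_comm, ← this]
    conv_rhs => rw [congrArg (Nat.cast (R := ZMod M)) hM]
    push_cast
    rfl
  refine ⟨((Int.castAddHom (ZMod M)).comp f).coprod (ZMod.lift (2 ^ k) ⟨_, h⟩), fun v c => ?_⟩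
  rw [AddMonoidHom.coprod_apply, ZMod.lift_coe, zmultiplesHom_apply, zsmul_eq_mul]
  push_cast
  rw [mul_comm]
  rfl

theorem eq_zero_of_intCast_eq_zero {j k M : ℕ} (hM : M = 2 ^ j * 2 ^ k) {x c : ℤ}
    (hx : |x| < 2 ^ j) (h : ((x + 2 ^ j * c : ℤ) : ZMod M) = 0) :
    x = 0 ∧ (c : ZMod (2 ^ k)) = 0 := by
  rw [ZMod.intCast_zmod_eq_zero_iff_dvd, hM] at h
  push_cast at h
  have hx0 : x = 0 := Int.eq_zero_of_abs_lt_dvd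
    ((dvd_add_left (dvd_mul_right _ c)).mp ((dvd_mul_right _ _).trans h)) hx
  refine ⟨hx0, ?_⟩
  rw [hx0, zero_add] at h
  rw [ZMod.intCast_zmod_eq_zero_iff_dvd]
  exact_mod_cast Int.dvd_of_mul_dvd_mul_left (by positivity) h

/-- A homomorphism `ℤ^l ⊕ ℤ_{2^k} → ℤ_{2m}` that maps `(0, 2^(k-1))` to `m` extends to the model
group. -/
theorem exists_hom_quaternionGroup {l k m : ℕ} (φ : (Fin l → ℤ) × ZMod (2 ^ k) →+ ZMod (2 * m))
    (hφ : φ (0, 2 ^ (k - 1)) = m) :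
    ∃ α : LimitModel l k →* QuaternionGroup m,
      (∀ a, α ((⟨.ofAdd a, .ofAdd 0⟩ : SemiProd l k) : LimitModel l k) = .a (φ a)) ∧
      ∀ a, α ((⟨.ofAdd a, .ofAdd 1⟩ : SemiProd l k) : LimitModel l k) = .xa (-φ a) := by
  let e : Multiplicative ((Fin l → ℤ) × ZMod (2 ^ k)) →* QuaternionGroup m :=
    { toFun := fun a => .a (φ a.toAdd)
      map_one' := by simp
      map_mul' := fun a b => by simp }
  refine ⟨modelHom l k e (.xa 0) (fun a => ?_) (QuaternionGroup.xa_pow_four 0) ?_,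
    fun a => ?_, fun a => ?_⟩
  · rw [mul_inv_eq_iff_eq_mul]
    change QuaternionGroup.xa 0 * .a (φ a.toAdd) = .a (φ (-a.toAdd)) * .xa 0
    rw [QuaternionGroup.xa_mul_a, QuaternionGroup.a_mul_xa, map_neg, sub_neg_eq_add]
  · rw [QuaternionGroup.xa_sq]
    exact congrArg _ hφ
  · rw [modelHom_mk, ZMod.val_zero, pow_zero, mul_one]
    rfl
  · rw [modelHom_mk, show (1 : ZMod 4).val = 1 from rfl, pow_one]
    change QuaternionGroup.a (φ a) * _ = _
    rw [QuaternionGroup.a_mul_xa, zero_sub]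

theorem FullyResidually.of_mulEquiv {X : (H : Type) → [Group H] → Prop} {G K : Type*} [Group G]
    [Group K] (hK : FullyResidually X K) (e : G ≃* K) : FullyResidually X G := by
  classical
  intro E
  obtain ⟨H, _, hH, α, hα⟩ := hK (E.image e)
  rw [Finset.coe_image] at hα
  exact ⟨H, _, hH, α.comp e.toMonoidHom, hα.comp e.injective.injOn (Set.mapsTo_image e E)⟩

theorem isQuaternion_quaternionGroup {m : ℕ} (hm : 1 ≤ m) :
    IsQuaternion (QuaternionGroup (2 ^ m)) :=
  ⟨m + 2, by omega, ⟨MulEquiv.refl _⟩⟩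

/-- Take a linear form `f` on `ℤ^l` that does not vanish on the relevant nonzero vectors, and map
`(v, c)` to `f v + 2^j c` in `ℤ_{2^(j+k)}`. For large `j` the small number `f v` is not confused
with a multiple of `2^j`. -/
theorem fullyResidually_limitModel {l k : ℕ} (hk : 1 ≤ k) :
    FullyResidually IsQuaternion (LimitModel l k) := by
  classical
  intro E
  choose rep hrep using LimitModel.exists_rep (l := l) (k := k)
  let D : Finset (Fin l → ℤ) := (E ×ˢ E).image fun q => (rep (q.1⁻¹ * q.2)).1
  obtain ⟨f, hf⟩ := exists_linearForm_ne_zero D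
  obtain ⟨j, hj, hfj⟩ : ∃ j : ℕ, 1 ≤ j ∧ ∀ v ∈ D, |f v| < 2 ^ j := by
    refine ⟨D.sup (fun v => (f v).natAbs) + 1, by omega, fun v hv => ?_⟩
    have h₁ : (f v).natAbs ≤ D.sup (fun v => (f v).natAbs) :=
      Finset.le_sup (f := fun v => (f v).natAbs) hv
    have h₂ := Nat.lt_two_pow_self (n := D.sup (fun v => (f v).natAbs) + 1)
    rw [Int.abs_eq_natAbs]
    exact_mod_cast (by omega : (f v).natAbs < 2 ^ (D.sup (fun v => (f v).natAbs) + 1))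
  have hM : 2 * 2 ^ (j + k - 1) = 2 ^ j * 2 ^ k := by
    rw [← pow_succ', ← pow_add, Nat.sub_add_cancel (by omega)]
  obtain ⟨φ, hφ⟩ := exists_addMonoidHom_zmod f hM
  obtain ⟨α, hα, hα'⟩ := exists_hom_quaternionGroup φ (by
    have := hφ 0 (2 ^ (k - 1))
    push_cast at this
    rw [this, map_zero, Int.cast_zero, zero_add, ← pow_add, Nat.add_sub_assoc hk]
    push_cast
    rfl)
  refine ⟨_, _, isQuaternion_quaternionGroup (by omega), α, fun x hx y hy hxy => ?_⟩
  rw [← inv_mul_eq_one]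
  have h1 : α (x⁻¹ * y) = 1 := by rw [map_mul, map_inv, hxy, inv_mul_cancel]
  have hD : (rep (x⁻¹ * y)).1 ∈ D := Finset.mem_image.mpr ⟨(x, y), Finset.mk_mem_product hx hy, rfl⟩
  generalize x⁻¹ * y = q at h1 hD
  obtain ⟨c, hc⟩ := ZMod.intCast_surjective (rep q).2
  rcases hrep q with h | h
  · rw [h, hα, a_eq_one_iff, ← Prod.mk.eta (p := rep q), ← hc, hφ] at h1
    obtain ⟨h₁, h₂⟩ := eq_zero_of_intCast_eq_zero hM (hfj _ hD) h1
    have h0 : rep q = 0 := Prod.ext (hf _ hD h₁) (hc.symm.trans h₂)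
    rw [h, h0]
    rfl
  · rw [h, hα'] at h1
    cases h1

/-! ### Subgroups of quaternion groups -/

theorem isQuaternion_of_mulEquiv {H K : Type} [Group H] [Group K] (e : H ≃* K)
    (hK : IsQuaternion K) : IsQuaternion H := by
  obtain ⟨n, hn, ⟨f⟩⟩ := hK
  exact ⟨n, hn, ⟨e.trans f⟩⟩

/-- Without a free part, the model group is the quaternion group of order `2^(k+1)`. -/
theorem nonempty_limitModel_zero_mulEquiv {k : ℕ} (hk : 1 ≤ k) :
    Nonempty (LimitModel 0 k ≃* QuaternionGroup (2 ^ (k - 1))) := by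
  have hM : 2 * 2 ^ (k - 1) = 2 ^ 0 * 2 ^ k := by
    rw [← pow_succ', Nat.sub_add_cancel (by omega), pow_zero, one_mul]
  obtain ⟨φ, hφ⟩ := exists_addMonoidHom_zmod (0 : (Fin 0 → ℤ) →+ ℤ) hM
  obtain ⟨α, hα, hα'⟩ := exists_hom_quaternionGroup φ (by
    have := hφ 0 (2 ^ (k - 1))
    push_cast at this
    rw [this, map_zero, Int.cast_zero, zero_add, one_mul]
    push_cast
    rfl)
  have hsurj (i : ZMod (2 * 2 ^ (k - 1))) : ∃ a, φ a = i := by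
    obtain ⟨c, rfl⟩ := ZMod.intCast_surjective i
    refine ⟨(0, (c : ZMod (2 ^ k))), ?_⟩
    rw [hφ, map_zero, zero_add, pow_zero, one_mul]
  refine ⟨MulEquiv.ofBijective α ⟨?_, ?_⟩⟩
  · rw [injective_iff_map_eq_one]
    intro q h1
    obtain ⟨⟨v, a⟩, rfl | rfl⟩ := q.exists_rep
    · obtain ⟨c, rfl⟩ := ZMod.intCast_surjective a
      rw [hα, a_eq_one_iff, hφ] at h1
      obtain ⟨-, h₂⟩ := eq_zero_of_intCast_eq_zero hM (by simp) h1
      rw [h₂, Subsingleton.elim v 0]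
      rfl
    · rw [hα'] at h1
      cases h1
  · rintro (i | i)
    · obtain ⟨a, rfl⟩ := hsurj i
      exact ⟨_, hα a⟩
    · obtain ⟨a, ha⟩ := hsurj (-i)
      exact ⟨_, by rw [hα' a, ha, neg_neg]⟩

/-- The model group with a free part is infinite, because it maps onto the infinite dihedral
group. -/
theorem infinite_limitModel {l : ℕ} (hl : l ≠ 0) (k : ℕ) : Infinite (LimitModel l k) := by
  let i : Fin l := ⟨0, by omega⟩
  let c : ℤ →+ ZMod 0 := Int.castAddHom (ZMod 0)
  have hc : Function.Injective c := Int.cast_injective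
  let e : Multiplicative ((Fin l → ℤ) × ZMod (2 ^ k)) →* DihedralGroup 0 :=
    { toFun := fun a => .r (c (a.toAdd.1 i))
      map_one' := congrArg DihedralGroup.r (map_zero c)
      map_mul' := fun a b => congrArg DihedralGroup.r (map_add c _ _) }
  let α := modelHom l k e (.sr 0)
    (fun a => by
      rw [mul_inv_eq_iff_eq_mul]
      change DihedralGroup.sr 0 * .r (c (a.toAdd.1 i)) = .r (c (-a.toAdd.1 i)) * .sr 0
      rw [DihedralGroup.sr_mul_r, DihedralGroup.r_mul_sr, map_neg, sub_neg_eq_add])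
    rfl (congrArg DihedralGroup.r (map_zero c))
  refine Infinite.of_injective
    (fun n : ℤ => ((⟨.ofAdd (fun _ => n, 0), .ofAdd 0⟩ : SemiProd l k) : LimitModel l k))
    fun n n' h => ?_
  have h' : DihedralGroup.r (c n) * 1 = .r (c n') * 1 := congrArg α h
  rw [mul_one, mul_one, DihedralGroup.r.injEq] at h'
  exact hc h'

/-- A finite nonabelian group that looks like a quaternion group is one: there is no room for a free
part in its model. -/
theorem IsQuaternionLike.isQuaternion {H : Type} [Group H] [Finite H]
    (hH : ¬ ∀ a b : H, a * b = b * a) {A : Subgroup H} (hA : IsQuaternionLike A) :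
    IsQuaternion H := by
  obtain ⟨l, k, hk, ⟨e⟩⟩ := hA.exists_mulEquiv_limitModel hH
  obtain rfl : l = 0 := by
    by_contra hl
    have := infinite_limitModel hl k
    exact not_finite_iff_infinite.mpr this (Finite.of_equiv H e.toEquiv)
  obtain ⟨e'⟩ := nonempty_limitModel_zero_mulEquiv hk
  refine isQuaternion_of_mulEquiv (e.trans e') (isQuaternion_quaternionGroup ?_)
  -- the case `k = 1` would give the cyclic group `QuaternionGroup 1`
  by_contra hk1
  obtain rfl : k = 1 := by omega
  have : IsCyclic (QuaternionGroup (2 ^ (1 - 1))) := QuaternionGroup.quaternionGroup_one_isCyclic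
  refine hH fun a b => (e.trans e').injective ?_
  rw [map_mul, map_mul]
  exact IsCyclic.isMulCommutative.is_comm.comm _ _

theorem IsQuaternion.subgroup {H : Type} [Group H] [Finite H] (hH : IsQuaternion H)
    (K : Subgroup H) (hK : ¬ ∀ a b : K, a * b = b * a) : IsQuaternion K := by
  obtain ⟨A, hA⟩ := hH.exists_isQuaternionLike
  exact (hA.comap K.subtype_injective).isQuaternion hK

/-! ### Universal sentences -/

/-- A group homomorphism as a homomorphism of structures. -/
def structureHom {G H : Type*} [Group G] [Group H] (α : G →* H) : G →[groupLanguage] H where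
  toFun := α
  map_fun' {n} f x := by
    cases f with
    | one => exact map_one α
    | inv => exact map_inv α (x 0)
    | mul => exact map_mul α (x 0) (x 1)
  map_rel' r := Empty.elim r

theorem realize_term_comp {G H β : Type*} [Group G] [Group H] (α : G →* H)
    (t : groupLanguage.Term β) (v : β → G) : t.realize (α ∘ v) = α (t.realize v) :=
  Language.HomClass.realize_term (structureHom α)

/-- Only finitely many elements of `G` matter for the truth of a quantifier-free formula. -/
theorem IsQF.exists_finset {G β : Type*} [Group G] {n : ℕ}
    {φ : groupLanguage.BoundedFormula β n} (hφ : φ.IsQF) (v : β → G) (xs : Fin n → G) :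
    ∃ E : Finset G, ∀ (H : Type) [Group H] (α : G →* H), Set.InjOn α (E : Set G) →
      (φ.Realize (α ∘ v) (α ∘ xs) ↔ φ.Realize v xs) := by
  classical
  induction hφ with
  | falsum => exact ⟨∅, fun H _ α _ => Iff.rfl⟩
  | of_isAtomic h =>
    cases h with
    | equal t₁ t₂ =>
      refine ⟨{t₁.realize (Sum.elim v xs), t₂.realize (Sum.elim v xs)}, fun H _ α hα => ?_⟩
      rw [Language.BoundedFormula.realize_bdEqual, Language.BoundedFormula.realize_bdEqual,
        ← Sum.comp_elim, realize_term_comp, realize_term_comp]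
      exact ⟨fun h => hα (by simp) (by simp) h, congrArg α⟩
    | rel R ts => exact Empty.elim R
  | imp _ _ ih₁ ih₂ =>
    obtain ⟨E₁, h₁⟩ := ih₁
    obtain ⟨E₂, h₂⟩ := ih₂
    refine ⟨E₁ ∪ E₂, fun H _ α hα => ?_⟩
    rw [Finset.coe_union] at hα
    rw [Language.BoundedFormula.realize_imp, Language.BoundedFormula.realize_imp,
      h₁ H α (hα.mono Set.subset_union_left), h₂ H α (hα.mono Set.subset_union_right)]

/-- The failure of a universal formula in `G` is witnessed by finitely many elements. -/
theorem IsUniversal.exists_finset {G β : Type*} [Group G] {n : ℕ}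
    {φ : groupLanguage.BoundedFormula β n} (hφ : φ.IsUniversal) (v : β → G) (xs : Fin n → G)
    (h : ¬ φ.Realize v xs) :
    ∃ E : Finset G, ∀ (H : Type) [Group H] (α : G →* H), Set.InjOn α (E : Set G) →
      ¬ φ.Realize (α ∘ v) (α ∘ xs) := by
  induction hφ with
  | of_isQF hφ =>
    obtain ⟨E, hE⟩ := IsQF.exists_finset hφ v xs
    exact ⟨E, fun H _ α hα h' => h ((hE H α hα).mp h')⟩
  | all _ ih =>
    rw [Language.BoundedFormula.realize_all, not_forall] at h
    obtain ⟨x, hx⟩ := h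
    obtain ⟨E, hE⟩ := ih _ hx
    refine ⟨E, fun H _ α hα h' => hE H α hα ?_⟩
    rw [Fin.comp_snoc]
    exact h' (α x)

theorem FullyResidually.universalTheory_subset {G : Type*} [Group G]
    (h : FullyResidually IsQuaternion G) :
    (⋂ (n : ℕ) (_ : 3 ≤ n), universalTheory (Q n)) ⊆ universalTheory G := by
  intro φ hφ
  rw [Set.mem_iInter₂] at hφ
  refine ⟨(hφ 3 le_rfl).1, ?_⟩
  by_contra hG
  obtain ⟨E, hE⟩ := IsUniversal.exists_finset (hφ 3 le_rfl).1 _ _ hG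
  obtain ⟨H, _, ⟨n, hn, ⟨e⟩⟩, α, hα⟩ := h E
  refine hE (Q n) (e.toMonoidHom.comp α) (e.injective.comp_injOn hα) ?_
  have := (hφ n hn).2
  rw [Language.Sentence.Realize, Language.Formula.Realize] at this
  convert this

theorem isUniversal_alls {β : Type*} {n : ℕ} {φ : groupLanguage.BoundedFormula β n}
    (hφ : φ.IsUniversal) : Language.BoundedFormula.IsUniversal φ.alls := by
  induction n with
  | zero => exact hφ
  | succ n ih => exact ih hφ.all

/-- A word in the generators of a free group, as a term in the language of groups. -/
def wordTerm {β : Type*} : List (β × Bool) → groupLanguage.Term (Empty ⊕ β)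
  | [] => .func (l := 0) (GroupFunc.one : groupLanguage.Functions 0) ![]
  | (b, true) :: L =>
    .func (l := 2) (GroupFunc.mul : groupLanguage.Functions 2) ![.var (.inr b), wordTerm L]
  | (b, false) :: L =>
    .func (l := 2) (GroupFunc.mul : groupLanguage.Functions 2)
      ![.func (l := 1) (GroupFunc.inv : groupLanguage.Functions 1) ![.var (.inr b)], wordTerm L]

theorem realize_wordTerm {β H : Type*} [Group H] (v : Empty → H) (T : β → H)
    (L : List (β × Bool)) :
    (wordTerm L).realize (Sum.elim v T) = FreeGroup.lift T (FreeGroup.mk L) := by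
  rw [FreeGroup.lift_mk]
  induction L with
  | nil => rfl
  | cons x L ih =>
    rw [List.map_cons, List.prod_cons, ← ih]
    rcases x with ⟨b, _ | _⟩ <;> rfl

/-- Every finite part of the diagram of a marked group is described by a quantifier-free formula. -/
theorem exists_isQF_realize {G : Type*} [Group G] {m : ℕ} (S : Fin m → G)
    (F : Finset (FreeGroup (Fin m))) :
    ∃ ψ : groupLanguage.BoundedFormula Empty m, ψ.IsQF ∧ ψ.Realize default S ∧
      ∀ (H : Type) [Group H] (T : Fin m → H), ψ.Realize default T →
        ∀ w ∈ F, (FreeGroup.lift T w = 1 ↔ FreeGroup.lift S w = 1) := by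
  classical
  induction F using Finset.induction_on with
  | empty => exact ⟨⊤, .top, Language.BoundedFormula.realize_top.mpr trivial, by simp⟩
  | insert w F _ ih =>
    obtain ⟨ψ, hψ, hS, h⟩ := ih
    let χ : groupLanguage.BoundedFormula Empty m := (wordTerm w.toWord).bdEqual (wordTerm [])
    have hχqf : χ.IsQF := (Language.BoundedFormula.IsAtomic.equal _ _).isQF
    have hχS : χ.Realize default S ↔ FreeGroup.lift S w = 1 := by
      rw [Language.BoundedFormula.realize_bdEqual, realize_wordTerm, realize_wordTerm,
        FreeGroup.mk_toWord, ← FreeGroup.one_eq_mk, map_one]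
    have hχT {H : Type} [Group H] (T : Fin m → H) :
        χ.Realize default T ↔ FreeGroup.lift T w = 1 := by
      rw [Language.BoundedFormula.realize_bdEqual, realize_wordTerm, realize_wordTerm,
        FreeGroup.mk_toWord, ← FreeGroup.one_eq_mk, map_one]
    by_cases hw : FreeGroup.lift S w = 1
    · refine ⟨ψ ⊓ χ, hψ.inf hχqf, Language.BoundedFormula.realize_inf.mpr ⟨hS, hχS.mpr hw⟩,
        fun H _ T hT => ?_⟩
      rw [Language.BoundedFormula.realize_inf, hχT] at hT
      rw [Finset.forall_mem_insert]
      exact ⟨iff_of_true hT.2 hw, h H T hT.1⟩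
    · refine ⟨ψ ⊓ χ.not, hψ.inf hχqf.not,
        Language.BoundedFormula.realize_inf.mpr ⟨hS, fun h => hw (hχS.mp h)⟩, fun H _ T hT => ?_⟩
      rw [Language.BoundedFormula.realize_inf, Language.BoundedFormula.realize_not, hχT] at hT
      rw [Finset.forall_mem_insert]
      exact ⟨iff_of_false hT.2 hw, h H T hT.1⟩

/-- If universal sentences pass from the quaternion groups to `G`, then every finite part of the
diagram of a tuple in `G` is realized by a tuple in a quaternion group. -/
theorem exists_quaternion_tuple_of_universalTheory_subset {G : Type*} [Group G]
    (h : (⋂ (n : ℕ) (_ : 3 ≤ n), universalTheory (Q n)) ⊆ universalTheory G) {m : ℕ}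
    (S : Fin m → G) (F : Finset (FreeGroup (Fin m))) :
    ∃ n : ℕ, 3 ≤ n ∧ ∃ T : Fin m → Q n,
      ∀ w ∈ F, (FreeGroup.lift T w = 1 ↔ FreeGroup.lift S w = 1) := by
  obtain ⟨ψ, hψ, hS, hF⟩ := exists_isQF_realize S F
  -- otherwise `∀ x₁ … ∀ xₘ, ¬ψ` holds in all quaternion groups, but it fails in `G` at `S`
  by_contra! hcon
  have hmem : ψ.not.alls ∈ ⋂ (n : ℕ) (_ : 3 ≤ n), universalTheory (Q n) := by
    rw [Set.mem_iInter₂]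
    refine fun n hn => ⟨isUniversal_alls (.of_isQF hψ.not), ?_⟩
    refine Language.BoundedFormula.realize_alls.mpr fun T hT => ?_
    obtain ⟨w, hw, hw'⟩ := hcon n hn T
    have := hF (Q n) T hT w hw
    grind
  exact Language.BoundedFormula.realize_alls.mp (h hmem).2 S hS

/-! ### Limits of marked groups -/

theorem tendsto_markedPoint_iff {G : Type*} [Group G] {m : ℕ} {S : Fin m → G} {H : ℕ → Type}
    [∀ i, Group (H i)] {T : ∀ i, Fin m → H i} :
    Tendsto (fun i => markedPoint (T i)) atTop (𝓝 (markedPoint S)) ↔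
      ∀ w, ∀ᶠ i in atTop, (FreeGroup.lift (T i) w = 1 ↔ FreeGroup.lift S w = 1) := by
  rw [nhds_induced, tendsto_comap_iff, tendsto_pi_nhds]
  refine forall_congr' fun w => ?_
  rw [nhds_discrete, tendsto_pure]
  refine eventually_congr (.of_forall fun i => ?_)
  exact decide_eq_decide

theorem IsMarking.lift_surjective {G : Type*} [Group G] {m : ℕ} {S : Fin m → G}
    (hS : IsMarking S) : Function.Surjective (FreeGroup.lift S) := by
  rw [← MonoidHom.range_eq_top, FreeGroup.range_lift_eq_closure]
  exact hS

theorem exists_isMarking (G : Type*) [Group G] [Group.FG G] :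
    ∃ (m : ℕ) (S : Fin m → G), IsMarking S := by
  obtain ⟨s, hs, hfin⟩ := Group.fg_iff.mp ‹Group.FG G›
  obtain ⟨m, S, -, rfl⟩ := hfin.fin_param
  exact ⟨m, S, hs⟩

/-- The words in the marking give a homomorphism from the free group to the ultraproduct, and
convergence says that its kernel consists of the relations of `G`. -/
theorem IsLimitOf.embedsInUltraproductOf {G : Type*} [Group G]
    {X : (H : Type) → [Group H] → Prop} (h : IsLimitOf X G) : EmbedsInUltraproductOf X G := by
  obtain ⟨m, S, H, _, T, hS, hX, -, hlim⟩ := h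
  rw [tendsto_markedPoint_iff] at hlim
  refine ⟨H, inferInstance, hyperfilter ℕ, hX, ?_⟩
  let F : FreeGroup (Fin m) →* Ultraproduct (hyperfilter ℕ) H :=
    (ultraCon (hyperfilter ℕ) H).mk'.comp (MonoidHom.pi fun i => FreeGroup.lift (T i))
  have hF (w) : F w = 1 ↔ FreeGroup.lift S w = 1 := by
    have hw : ∀ᶠ i in hyperfilter ℕ, (FreeGroup.lift (T i) w = 1 ↔ FreeGroup.lift S w = 1) :=
      Nat.hyperfilter_le_atTop (hlim w)
    refine (ultraproduct_eq_iff (y := 1)).trans ?_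
    change (∀ᶠ i in hyperfilter ℕ, FreeGroup.lift (T i) w = 1) ↔ _
    rw [eventually_congr hw, eventually_const]
  have hker : (FreeGroup.lift S).ker = F.ker := by
    ext w
    exact (hF w).symm
  let e := (QuotientGroup.quotientKerEquivOfSurjective _ hS.lift_surjective).symm.trans
    (QuotientGroup.quotientMulEquivOfEq hker)
  exact ⟨(QuotientGroup.kerLift F).comp e.toMonoidHom,
    (QuotientGroup.kerLift_injective F).comp e.injective⟩

open scoped commutatorElement in
/-- The witness of noncommutativity is part of the diagram, so the approximating tuples generate
nonabelian subgroups of quaternion groups, and these are quaternion groups. -/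
theorem isLimitOf_of_universalTheory_subset {G : Type*} [Group G] [Group.FG G]
    (hG : ¬ ∀ a b : G, a * b = b * a)
    (h : (⋂ (n : ℕ) (_ : 3 ≤ n), universalTheory (Q n)) ⊆ universalTheory G) :
    IsLimitOf IsQuaternion G := by
  classical
  obtain ⟨m, S, hS⟩ := exists_isMarking G
  push Not at hG
  obtain ⟨a, b, hab⟩ := hG
  obtain ⟨a, rfl⟩ := hS.lift_surjective a
  obtain ⟨b, rfl⟩ := hS.lift_surjective b
  obtain ⟨enum, henum⟩ := exists_surjective_nat (FreeGroup (Fin m))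
  choose n hn T hT using fun i : ℕ => exists_quaternion_tuple_of_universalTheory_subset h S
    (insert ⁅a, b⁆ ((Finset.range (i + 1)).image enum))
  let K (i : ℕ) : Subgroup (Q (n i)) := Subgroup.closure (Set.range (T i))
  let T' (i : ℕ) (x : Fin m) : K i := ⟨T i x, Subgroup.subset_closure ⟨x, rfl⟩⟩
  have hT' (i : ℕ) (w) : ((FreeGroup.lift (T' i) w : K i) : Q (n i)) = FreeGroup.lift (T i) w := by
    have : (K i).subtype.comp (FreeGroup.lift (T' i)) = FreeGroup.lift (T i) := by
      ext x
      simp [T']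
    exact DFunLike.congr_fun this w
  refine ⟨m, S, fun i => K i, inferInstance, T', hS, fun i => ?_, fun i => ?_, ?_⟩
  · have : NeZero (2 ^ (n i - 2)) := ⟨by positivity⟩
    refine IsQuaternion.subgroup ⟨n i, hn i, ⟨MulEquiv.refl _⟩⟩ (K i) fun hcomm => hab ?_
    have h1 := hcomm (FreeGroup.lift (T' i) a) (FreeGroup.lift (T' i) b)
    rw [← commutatorElement_eq_one_iff_mul_comm, ← map_commutatorElement] at h1 ⊢
    rw [← hT i _ (Finset.mem_insert_self _ _), ← hT', h1, Subgroup.coe_one]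
  · refine Subgroup.map_injective (K i).subtype_injective ?_
    rw [MonoidHom.map_closure, ← Set.range_comp, ← MonoidHom.range_eq_map, Subgroup.range_subtype]
    rfl
  · rw [tendsto_markedPoint_iff]
    intro w
    obtain ⟨j, rfl⟩ := henum w
    filter_upwards [eventually_ge_atTop j] with i hi
    rw [← hT i (enum j) (Finset.mem_insert_of_mem (Finset.mem_image_of_mem _
      (Finset.mem_range.mpr (by omega)))), ← hT', OneMemClass.coe_eq_one]

end QuaternionLimits

theorem theorem6 {G : Type*} [Group G] [Group.FG G] (hG : ¬ ∀ a b : G, a * b = b * a) :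
    List.TFAE [
      QuaternionLimits.IsLimitOf QuaternionLimits.IsQuaternion G,
      QuaternionLimits.FullyResidually QuaternionLimits.IsQuaternion G,
      ∃ l k : ℕ, 1 ≤ k ∧ Nonempty (G ≃* QuaternionLimits.LimitModel l k),
      (⋂ (n : ℕ) (_ : 3 ≤ n), QuaternionLimits.universalTheory (QuaternionLimits.Q n)) ⊆
        QuaternionLimits.universalTheory G,
      QuaternionLimits.EmbedsInUltraproductOf QuaternionLimits.IsQuaternion G] := by
  tfae_have 1 → 5 := QuaternionLimits.IsLimitOf.embedsInUltraproductOf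
  tfae_have 5 → 3 := fun h => by
    obtain ⟨A, hA⟩ := h.exists_isQuaternionLike
    exact hA.exists_mulEquiv_limitModel hG
  tfae_have 3 → 2 := fun ⟨l, k, hk, ⟨e⟩⟩ =>
    (QuaternionLimits.fullyResidually_limitModel hk).of_mulEquiv e
  tfae_have 2 → 4 := QuaternionLimits.FullyResidually.universalTheory_subset
  tfae_have 4 → 1 := QuaternionLimits.isLimitOf_of_universalTheory_subset hG
  tfae_finish
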